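/- For integers $g,p\ge 0$ with $2g-2+p>0$, let $\mathrm{Graph}(g,p)$ be the set of connected finite graphs (loops and multiple edges allowed) of rank $g$ with $p$ marked vertices of valence $1$, labeled $1,\dots,p$, and $2g-2+p$ vertices of valence $3$, up to isomorphism preserving the labels. A Whitehead move on an edge $e$ that joins two distinct vertices of valence $3$ collapses $e$ and reopens it in one of the two other directions. Let $d_W$ be the path metric on $\mathrm{Graph}(g,p)$ in which two distinct elements have distance $1$ if and only if they differ by a single Whitehead move. Then there are universal constants $c,C>0$ such that for all $g,p\ge 0$ with $2g-2+p>0$, any two elements of $\mathrm{Graph}(g,p)$ are joined by a finite sequence of Whitehead moves, the diameter is finite, and \[ \operatorname{diam}_W\big(\mathrm{Graph}(g,p)\big)\le C\,(g+p)\log(g+p), \] and, if moreover $(g,p)\ne(0,3)$ and $(g,p)\neq(1,1)$, \[ c\,(g+p)\log(g+p)\le \operatorname{diam}_W\big(\mathrm{Graph}(g,p)\big). \] -/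

import Mathlib

namespace TrivalentGraphs

/-- The half-edges of a graph with `p` marked vertices of valence one and `m` vertices of
valence three: one at each marked vertex, three at each of the others. -/
abbrev HalfEdge (p m : ℕ) : Type := Fin p ⊕ (Fin m × Fin 3)

/-- The vertices: `Sum.inl i` is the marked (univalent) vertex with label `i`, and the
`Sum.inr j` are the trivalent vertices. -/
abbrev Vertex (p m : ℕ) : Type := Fin p ⊕ Fin m

/-- The vertex at which a half-edge is attached. -/
def vert {p m : ℕ} : HalfEdge p m → Vertex p m := Sum.map id Prod.fst

/-- A connected finite graph (loops and multiple edges are allowed) with `p` labeled vertices of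
valence one and `m` vertices of valence three. The edges are the pairs `{h, opp h}`. -/
@[ext]
structure MarkedGraph (p m : ℕ) where
  /-- The other half of the edge that contains a given half-edge. -/
  opp : HalfEdge p m → HalfEdge p m
  opp_opp : ∀ h, opp (opp h) = h
  opp_ne : ∀ h, opp h ≠ h
  connected :
    (SimpleGraph.fromRel fun u v : Vertex p m => ∃ h, vert h = u ∧ vert (opp h) = v).Connected

namespace MarkedGraph

variable {p m : ℕ}

/-- The edges of a graph, each as the unordered pair of its two half-edges. -/
def edges (G : MarkedGraph p m) : Finset (Sym2 (HalfEdge p m)) :=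
  Finset.univ.image fun h => s(h, G.opp h)

/-- `G` and `G'` are isomorphic as graphs with labeled marked vertices: there is a bijection `σ`
of half-edges and a bijection of vertices that fixes every marked vertex, compatible with the
attachment of half-edges to vertices and with the pairing of half-edges into edges. -/
def Iso (G G' : MarkedGraph p m) : Prop :=
  ∃ (σ : Equiv.Perm (HalfEdge p m)) (τ : Equiv.Perm (Vertex p m)),
    (∀ i : Fin p, τ (Sum.inl i) = Sum.inl i) ∧
    (∀ h, vert (σ h) = τ (vert h)) ∧
    (∀ h, σ (G.opp h) = G'.opp (σ h))

/-- Isomorphism is an equivalence relation. -/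
instance isoSetoid (p m : ℕ) : Setoid (MarkedGraph p m) where
  r := Iso
  iseqv :=
    { refl := fun _ => ⟨1, 1, fun _ => rfl, fun _ => rfl, fun _ => rfl⟩
      symm := by
        rintro G G' ⟨σ, τ, h1, h2, h3⟩
        refine ⟨σ.symm, τ.symm, fun i => ?_, fun h => ?_, fun h => ?_⟩
        · rw [Equiv.symm_apply_eq, h1]
        · rw [Equiv.eq_symm_apply, ← h2, Equiv.apply_symm_apply]
        · rw [Equiv.symm_apply_eq, h3, Equiv.apply_symm_apply]
      trans := by
        rintro G G' G'' ⟨σ, τ, h1, h2, h3⟩ ⟨σ', τ', h1', h2', h3'⟩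
        refine ⟨σ.trans σ', τ.trans τ', fun i => ?_, fun h => ?_, fun h => ?_⟩
        · simp [h1, h1']
        · simp [h2, h2']
        · simp [h3, h3'] }

/-- `G'` results from `G` by a Whitehead move on the edge `{h, opp h}`. This edge has distinct
endpoints, and it is interior (both endpoints are trivalent, because there are `a` and `b` as
below). Collapsing the edge and reopening it in another direction exchanges the attaching place
of one of the two other half-edges `a` at the one endpoint with that of one of the two other
half-edges `b` at the other endpoint; the four choices of `(a, b)` give the two ways to reopen,
each of them twice. -/
def WhiteheadMove (G G' : MarkedGraph p m) : Prop :=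
  ∃ h a b : HalfEdge p m,
    vert h ≠ vert (G.opp h) ∧
    (a ≠ h ∧ vert a = vert h) ∧
    (b ≠ G.opp h ∧ vert b = vert (G.opp h)) ∧
    ∀ x, G'.opp x = Equiv.swap a b (G.opp (Equiv.swap a b x))

end MarkedGraph

/-- The space of graphs of rank `g` with `p` labeled marked vertices of valence one and
`2g - 2 + p` vertices of valence three, up to isomorphism preserving the labels. -/
abbrev PGraph (g p : ℕ) : Type :=
  Quotient (MarkedGraph.isoSetoid p (2 * g + p - 2))

/-- The members of `PGraph g p` have rank `g`, where the rank of a connected graph is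
`#edges - #vertices + 1`. -/
theorem MarkedGraph.rank_eq (g p : ℕ) (hgp : 2 < 2 * g + p)
    (G : MarkedGraph p (2 * g + p - 2)) :
    (G.edges.card : ℤ) - Fintype.card (Vertex p (2 * g + p - 2)) + 1 = g := by
  have hsum := Finset.card_eq_sum_card_image (fun h => s(h, G.opp h)) Finset.univ
  have hfib : ∀ e ∈ Finset.univ.image (fun h => s(h, G.opp h)),
      (Finset.univ.filter fun h => s(h, G.opp h) = e).card = 2 := by
    intro e he
    obtain ⟨h, -, rfl⟩ := Finset.mem_image.1 he
    rw [show (Finset.univ.filter fun x => s(x, G.opp x) = s(h, G.opp h)) = {h, G.opp h} from ?_]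
    · exact Finset.card_pair (G.opp_ne h).symm
    · ext x
      simp only [Finset.mem_filter, Finset.mem_univ, true_and, Finset.mem_insert,
        Finset.mem_singleton, Sym2.eq_iff]
      constructor
      · rintro (⟨hx, -⟩ | ⟨hx, -⟩) <;> simp [hx]
      · rintro (rfl | rfl)
        · simp
        · simp [G.opp_opp]
  rw [Finset.sum_congr rfl hfib, Finset.sum_const, Finset.card_univ] at hsum
  change _ = G.edges.card • 2 at hsum
  simp only [Fintype.card_sum, Fintype.card_prod, Fintype.card_fin, smul_eq_mul] at hsum ⊢
  omega

/-- The graph on `PGraph g p` in which two distinct members are adjacent if they differ by a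
Whitehead move. Its path metric is the metric `d_W` of Whitehead moves. -/
def whiteheadGraph (g p : ℕ) : SimpleGraph (PGraph g p) :=
  SimpleGraph.fromRel fun x y =>
    ∃ G G' : MarkedGraph p (2 * g + p - 2), ⟦G⟧ = x ∧ ⟦G'⟧ = y ∧ G.WhiteheadMove G'

end TrivalentGraphs

/-!
Exchanging two half-edges `a` and `b`, attached next to the two ends of an edge, is a Whitehead
move, and it conjugates the involution `opp` by the transposition of `a` and `b`. Names of vertices
and half-edges are kept under moves, so sequences of moves are products of transpositions, and moves
at disjoint edges commute.

*Upper bound.* The vertices are arranged along the binary tree in heap order, which has logarithmic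
depth. A half-edge outside the tree can be exchanged with the free half-edge at the root by
`O(log m)` moves that leave everything else in place (`RootPath.exists_swap_root`), hence so can any
two half-edges outside the tree (`HeapPrefix.exists_swap`). Since a graph is connected, some
half-edge leads out of an incomplete tree; it is brought to the place where the next vertex is
missing, and after `m` such steps the graph contains the whole tree (`exists_heapPrefix`). Two
graphs that contain the whole tree differ only by the pairing of the half-edges outside it, and each
exchange corrects one of these (`HeapPrefix.within`).

*Lower bound.* There are many graphs: `(g + p)!` ways to attach the remaining edges to the given
tree lead to different graphs, of which only exponentially many can be isomorphic to each other
(`factorial_le`). On the other hand, only `2 ^ O(m + k)` graphs can be reached by `k` moves, rather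
than the `m ^ k` of the obvious estimate (`Reach.ncard_le`). Indeed, as moves at disjoint edges
commute, a sequence of moves can be replayed, up to its order, by anyone who knows for each vertex
on which of its three half-edges its next move takes place: a move can be performed as soon as both
ends of an edge agree on it. So the diameter `D` satisfies `(g + p)! ≤ 2 ^ O(g + p + D)`. For small
`g + p` the estimate is empty, and it is enough that there are two graphs that are not isomorphic.
-/

namespace TrivalentGraphs

open Equiv

variable {p m g : ℕ}

/-! ### Connectivity and conjugation -/

@[simp]
theorem vert_inl (i : Fin p) : vert (Sum.inl i : HalfEdge p m) = Sum.inl i := rfl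

@[simp]
theorem vert_inr (v : Fin m) (i : Fin 3) : vert (Sum.inr (v, i) : HalfEdge p m) = Sum.inr v := rfl

/-- A property of vertices that is inherited along edges holds everywhere once it holds
somewhere. -/
theorem MarkedGraph.forall_of_closed (G : MarkedGraph p m) (f : Vertex p m → Prop)
    (hf : ∀ x, f (vert x) → f (vert (G.opp x))) {u : Vertex p m} (hu : f u) (v : Vertex p m) :
    f v := by
  obtain ⟨w⟩ := G.connected.preconnected u v
  induction w with
  | nil => exact hu
  | cons h _ ih =>
    refine ih ?_
    rw [SimpleGraph.fromRel_adj] at h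
    obtain ⟨-, ⟨x, rfl, rfl⟩ | ⟨x, rfl, rfl⟩⟩ := h
    · exact hf x hu
    · simpa [G.opp_opp] using hf _ hu

/-- The converse of `MarkedGraph.forall_of_closed`. -/
theorem connected_of_forall_closed [Nonempty (Vertex p m)]
    (opp : HalfEdge p m → HalfEdge p m)
    (H : ∀ f : Vertex p m → Prop, (∀ x, f (vert x) → f (vert (opp x))) → ∀ u v, f u → f v) :
    (SimpleGraph.fromRel fun u v : Vertex p m =>
      ∃ h, vert h = u ∧ vert (opp h) = v).Connected := by
  rw [SimpleGraph.connected_iff]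
  refine ⟨fun u v => ?_, inferInstance⟩
  refine H (fun w => SimpleGraph.Reachable _ u w) (fun x hx => ?_) u v (SimpleGraph.Reachable.refl _)
  by_cases hxy : vert x = vert (opp x)
  · rwa [← hxy]
  · refine hx.trans (SimpleGraph.Adj.reachable ?_)
    rw [SimpleGraph.fromRel_adj]
    exact ⟨hxy, Or.inl ⟨x, rfl, rfl⟩⟩

/-- `G'` results from `G` by letting each half-edge `x` take the attaching place of `s x`. -/
def IsConj (G : MarkedGraph p m) (s : Perm (HalfEdge p m)) (G' : MarkedGraph p m) : Prop :=
  ∀ x, G'.opp (s x) = s (G.opp x)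

theorem IsConj.trans {G G' G'' : MarkedGraph p m} {s t : Perm (HalfEdge p m)}
    (h : IsConj G s G') (h' : IsConj G' t G'') : IsConj G (t * s) G'' := fun x => by
  simp only [Perm.mul_apply]
  rw [h', h]

theorem IsConj.symm {G G' : MarkedGraph p m} {s : Perm (HalfEdge p m)}
    (h : IsConj G s G') : IsConj G' s⁻¹ G := fun x => by
  rw [Perm.eq_inv_iff_eq, ← h]
  exact congrArg G'.opp (s.apply_symm_apply x)

theorem IsConj.apply_swap {G G' : MarkedGraph p m} {a b : HalfEdge p m}
    (h : IsConj G (swap a b) G') (x : HalfEdge p m) :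
    G'.opp x = swap a b (G.opp (swap a b x)) := by
  rw [← h, swap_apply_self]

theorem IsConj.unique {G G' G'' : MarkedGraph p m} {s : Perm (HalfEdge p m)}
    (h : IsConj G s G') (h' : IsConj G s G'') : G' = G'' := by
  ext1
  funext x
  rw [← s.apply_symm_apply x, h, h']

theorem IsConj.apply_of_ne {G G' : MarkedGraph p m} {a b x : HalfEdge p m}
    (h : IsConj G (swap a b) G') (h1 : x ≠ a) (h2 : x ≠ b) (h3 : G.opp x ≠ a)
    (h4 : G.opp x ≠ b) : G'.opp x = G.opp x := by
  rw [h.apply_swap, swap_apply_of_ne_of_ne h1 h2, swap_apply_of_ne_of_ne h3 h4]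

/-- Conjugation by `s` leads to a connected graph if, up to a permutation of the vertices, `s`
moves half-edges only between vertices that stay connected. -/
theorem exists_isConj (G : MarkedGraph p m) (s : Perm (HalfEdge p m)) (τ : Perm (Vertex p m))
    (H : ∀ f : Vertex p m → Prop, (∀ x, f (vert (s x)) ↔ f (vert (s (G.opp x)))) →
      ∀ x, f (vert (s x)) ↔ f (τ (vert x))) :
    ∃ G', IsConj G s G' := by
  have : Nonempty (Vertex p m) := G.connected.nonempty
  refine ⟨⟨fun x => s (G.opp (s.symm x)), fun x => by simp [G.opp_opp], fun x hx => ?_,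
    connected_of_forall_closed _ fun f hf u v hu => ?_⟩, fun x => by simp⟩
  · rw [← Equiv.eq_symm_apply] at hx
    exact G.opp_ne _ hx
  · have hf' : ∀ x, f (vert (s x)) ↔ f (vert (s (G.opp x))) := fun x =>
      ⟨fun h => by simpa using hf _ h, fun h => by simpa [G.opp_opp] using hf _ h⟩
    have := G.forall_of_closed (fun w => f (τ w))
      (fun x hx => by rwa [← H f hf', ← hf', H f hf']) (u := τ.symm u) (by simpa using hu)
      (τ.symm v)
    simpa using this

/-- Renaming the half-edges and the vertices compatibly gives an isomorphic graph. -/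
theorem exists_isConj_iso (G : MarkedGraph p m) {s : Perm (HalfEdge p m)} {τ : Perm (Vertex p m)}
    (hτ : ∀ i, τ (Sum.inl i) = Sum.inl i) (hs : ∀ x, vert (s x) = τ (vert x)) :
    ∃ G', IsConj G s G' ∧ G.Iso G' := by
  obtain ⟨G', hG'⟩ := exists_isConj G s τ fun f _ x => by rw [hs]
  exact ⟨G', hG', s, τ, hτ, hs, fun x => (hG' x).symm⟩

theorem vert_swap {a b : HalfEdge p m} (hab : vert a = vert b) (x : HalfEdge p m) :
    vert (swap a b x) = vert x := by
  by_cases h1 : x = a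
  · simp [h1, hab]
  by_cases h2 : x = b
  · simp [h2, hab]
  rw [swap_apply_of_ne_of_ne h1 h2]

/-- The data of a Whitehead move: the half-edges `a` and `b` are attached next to `h` and to
the other half of its edge, whose endpoints are distinct. -/
structure Movable (G : MarkedGraph p m) (h a b : HalfEdge p m) : Prop where
  ne : vert h ≠ vert (G.opp h)
  ane : a ≠ h
  va : vert a = vert h
  bne : b ≠ G.opp h
  vb : vert b = vert (G.opp h)

theorem Movable.opp_eq {G G' : MarkedGraph p m} {h a b : HalfEdge p m} (hm : Movable G h a b)
    (hc : IsConj G (swap a b) G') : G'.opp h = G.opp h := by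
  obtain ⟨h1, h2, h3, h4, h5⟩ := hm
  refine hc.apply_of_ne h2.symm ?_ ?_ h4.symm
  · rintro rfl; exact h1 h5
  · intro h; rw [h] at h1; exact h1 h3.symm

theorem Movable.exists_isConj {G : MarkedGraph p m} {h a b : HalfEdge p m}
    (hm : Movable G h a b) : ∃ G', IsConj G (swap a b) G' := by
  refine TrivalentGraphs.exists_isConj G (swap a b) 1 fun f hf x => ?_
  obtain ⟨h1, h2, h3, h4, h5⟩ := hm
  have e1 : swap a b h = h := swap_apply_of_ne_of_ne h2.symm (by rintro rfl; exact h1 h5)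
  have e2 : swap a b (G.opp h) = G.opp h :=
    swap_apply_of_ne_of_ne (fun h => by rw [h] at h1; exact h1 h3.symm) h4.symm
  have key := hf h
  rw [e1, e2, ← h3, ← h5] at key
  by_cases ha : x = a
  · simp [ha, key]
  by_cases hb : x = b
  · simp [hb, key]
  rw [swap_apply_of_ne_of_ne ha hb]; rfl

theorem whiteheadMove_iff {G G' : MarkedGraph p m} :
    G.WhiteheadMove G' ↔ ∃ h a b, Movable G h a b ∧ IsConj G (swap a b) G' := by
  constructor
  · rintro ⟨h, a, b, h1, ⟨h2, h3⟩, ⟨h4, h5⟩, h6⟩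
    exact ⟨h, a, b, ⟨h1, h2, h3, h4, h5⟩, fun x => by rw [h6, swap_apply_self]⟩
  · rintro ⟨h, a, b, ⟨h1, h2, h3, h4, h5⟩, hc⟩
    exact ⟨h, a, b, h1, ⟨h2, h3⟩, ⟨h4, h5⟩, hc.apply_swap⟩

theorem Movable.symm {G G' : MarkedGraph p m} {h a b : HalfEdge p m} (hm : Movable G h a b)
    (hc : IsConj G (swap a b) G') : Movable G' h a b := by
  have := hm.opp_eq hc
  obtain ⟨h1, h2, h3, h4, h5⟩ := hm
  exact ⟨by rwa [this], h2, h3, by rwa [this], by rwa [this]⟩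

theorem IsConj.swap_symm {G G' : MarkedGraph p m} {a b : HalfEdge p m}
    (h : IsConj G (swap a b) G') : IsConj G' (swap a b) G := by
  simpa using h.symm

theorem whiteheadMove_symm {G G' : MarkedGraph p m} (h : G.WhiteheadMove G') :
    G'.WhiteheadMove G := by
  rw [whiteheadMove_iff] at h ⊢
  obtain ⟨h, a, b, hm, hc⟩ := h
  exact ⟨h, a, b, hm.symm hc, hc.swap_symm⟩

/-- The graph of isomorphism classes and Whitehead moves, for arbitrary numbers of marked and
trivalent vertices. -/
def classGraph (p m : ℕ) : SimpleGraph (Quotient (MarkedGraph.isoSetoid p m)) :=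
  SimpleGraph.fromRel fun x y =>
    ∃ G G' : MarkedGraph p m, ⟦G⟧ = x ∧ ⟦G'⟧ = y ∧ G.WhiteheadMove G'

/-- `G'` is isomorphic to a graph at distance at most `n` from `G`. -/
def Within (n : ℕ) (G G' : MarkedGraph p m) : Prop :=
  ∃ w : (classGraph p m).Walk ⟦G⟧ ⟦G'⟧, w.length ≤ n

theorem Within.of_iso {G G' : MarkedGraph p m} (h : G.Iso G') : Within 0 G G' := by
  have : (⟦G⟧ : Quotient (MarkedGraph.isoSetoid p m)) = ⟦G'⟧ := Quotient.sound h
  unfold Within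
  rw [← this]
  exact ⟨.nil, le_rfl⟩

theorem Within.refl (G : MarkedGraph p m) : Within 0 G G := ⟨.nil, le_rfl⟩

theorem Within.mono {n k : ℕ} {G G' : MarkedGraph p m} (h : Within n G G') (hk : n ≤ k) :
    Within k G G' := h.imp fun _ hw => hw.trans hk

theorem Within.trans {n k : ℕ} {G G' G'' : MarkedGraph p m} (h : Within n G G')
    (h' : Within k G' G'') : Within (n + k) G G'' := by
  obtain ⟨w, hw⟩ := h
  obtain ⟨w', hw'⟩ := h'
  exact ⟨w.append w', by rw [SimpleGraph.Walk.length_append]; omega⟩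

theorem Within.symm {n : ℕ} {G G' : MarkedGraph p m} (h : Within n G G') : Within n G' G := by
  obtain ⟨w, hw⟩ := h
  exact ⟨w.reverse, by rwa [SimpleGraph.Walk.length_reverse]⟩

theorem Within.of_move {G G' : MarkedGraph p m} (h : G.WhiteheadMove G') : Within 1 G G' := by
  by_cases heq : (⟦G⟧ : Quotient (MarkedGraph.isoSetoid p m)) = ⟦G'⟧
  · exact (Within.of_iso (Quotient.exact heq)).mono zero_le_one
  · refine ⟨SimpleGraph.Adj.toWalk ?_, le_of_eq (SimpleGraph.Walk.length_cons _ _)⟩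
    rw [classGraph, SimpleGraph.fromRel_adj]
    exact ⟨heq, Or.inl ⟨G, G', rfl, rfl, h⟩⟩

/-! ### Spanning trees in heap order -/

/-- The parent of a trivalent vertex in the binary tree in heap order: the children of `u` are
`2u + 1` and `2u + 2`. The root `0` is its own parent. -/
def par (v : Fin m) : Fin m := ⟨(v.1 - 1) / 2, lt_of_le_of_lt (by omega) v.2⟩

/-- The half-edge at the parent, `1` or `2`, that leads to the child `v`. -/
def side (v : Fin m) : Fin 3 := if v.1 % 2 = 1 then 1 else 2

/-- The half-edge at `v` that leads to the parent of `v`. -/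
def up (v : Fin m) : HalfEdge p m := Sum.inr (v, 0)

/-- The half-edge at the parent of `v` that leads to `v`. -/
def down (v : Fin m) : HalfEdge p m := Sum.inr (par v, side v)

theorem par_lt {v : Fin m} (hv : 0 < v.1) : (par v).1 < v.1 := by
  simp only [par]; omega

theorem side_ne_zero (v : Fin m) : side v ≠ 0 := by
  unfold side; split <;> decide

theorem eq_of_par_eq_of_side_eq {v w : Fin m} (hv : 0 < v.1) (hw : 0 < w.1) (h1 : par v = par w)
    (h2 : side v = side w) : v = w := by
  simp only [par, side, Fin.mk.injEq] at h1 h2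
  ext
  split at h2 <;> split at h2 <;> omega

/-- The first `k` trivalent vertices form the binary tree in heap order. -/
def HeapPrefix (G : MarkedGraph p m) (k : ℕ) : Prop :=
  ∀ v : Fin m, 0 < v.1 → v.1 < k → G.opp (up v) = down v

/-- The path from `v` to the root runs through the parents as in the tree in heap order. -/
def RootPath (G : MarkedGraph p m) (v : Fin m) : Prop :=
  ∀ t, 0 < (par^[t] v).1 → G.opp (up (par^[t] v)) = down (par^[t] v)

theorem iterate_par_le (t : ℕ) (v : Fin m) : (par^[t] v).1 ≤ v.1 := by
  induction t with
  | zero => exact le_rfl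
  | succ t ih =>
    rw [Function.iterate_succ_apply']
    refine le_trans ?_ ih
    simp only [par]; omega

theorem HeapPrefix.rootPath {G : MarkedGraph p m} {k : ℕ} (h : HeapPrefix G k) {v : Fin m}
    (hv : v.1 < k) : RootPath G v :=
  fun t ht => h _ ht ((iterate_par_le t v).trans_lt hv)

/-- The half-edge at the root of the tree that is not part of the tree. -/
def root [NeZero m] : HalfEdge p m := Sum.inr (0, 0)

/-- A half-edge whose path to the root follows the tree can be exchanged with the root half-edge
at logarithmic cost: it is moved up to the parent in exchange for its sibling `c`, then `c` is
exchanged with the root half-edge, and finally the first move is undone. -/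
theorem RootPath.exists_swap_root [NeZero m] (G : MarkedGraph p m) (v : Fin m) (i : Fin 3)
    (hv : RootPath G v) (hi : i ≠ 0) :
    ∃ G', IsConj G (swap (Sum.inr (v, i)) root) G' ∧ Within (2 * Nat.log 2 (v.1 + 1)) G G' := by
  induction hn : v.1 using Nat.strong_induction_on generalizing G v i with
  | _ n ih =>
  subst hn
  rcases Nat.eq_zero_or_pos v.1 with h0 | hpos
  · have hv0 : v = 0 := by ext; simpa using h0
    subst hv0
    obtain ⟨G', h1, h2⟩ := exists_isConj_iso G (τ := 1) (fun _ => rfl)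
      (vert_swap (a := Sum.inr ((0 : Fin m), i)) (b := root) rfl)
    exact ⟨G', h1, (Within.of_iso h2).mono (Nat.zero_le _)⟩
  -- `j` is the side of the sibling of `v`.
  obtain ⟨j, hj0, hj⟩ : ∃ j : Fin 3, j ≠ 0 ∧ j ≠ side v := by
    generalize side v = s
    revert s; decide
  have hpv := par_lt hpos
  have hne : v ≠ par v := fun h => by rw [← h] at hpv; exact lt_irrefl _ hpv
  have hov : G.opp (up v) = down v := hv 0 hpos
  have hmov : Movable G (up v) (Sum.inr (v, i)) (Sum.inr (par v, j)) := by
    refine ⟨?_, ?_, rfl, ?_, ?_⟩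
    · rw [hov]; simpa [vert, up, down] using hne
    · simpa [up] using hi
    · rw [hov]; simpa [down] using hj
    · rw [hov]; rfl
  obtain ⟨G₁, hc₁⟩ := hmov.exists_isConj
  have hR : RootPath G₁ (par v) := by
    intro t ht
    have hle := iterate_par_le t (par v)
    have hw := hv (t + 1) (by simpa using ht)
    rw [Function.iterate_succ_apply] at hw
    generalize par^[t] (par v) = w at *
    have hpw := par_lt ht
    rw [hc₁.apply_of_ne, hw]
    · simp [up, hi.symm]
    · simp [up, hj0.symm]
    · rw [hw]; simp only [down, ne_eq, Sum.inr.injEq, Prod.mk.injEq, Fin.ext_iff, not_and]; omega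
    · rw [hw]; simp only [down, ne_eq, Sum.inr.injEq, Prod.mk.injEq, Fin.ext_iff, not_and]; omega
  obtain ⟨G₂, hc₂, hw₂⟩ := ih _ hpv G₁ (par v) j hR hj0 rfl
  -- The last move takes place on the same edge as the first one.
  have hov₁ : G₁.opp (up v) = down v := by rw [hmov.opp_eq hc₁, hov]
  have hov₂ : G₂.opp (up v) = down v := by
    rw [hc₂.apply_of_ne, hov₁]
    · simp [up, hne]
    · intro h
      simp only [up, root, Sum.inr.injEq, Prod.mk.injEq, and_true] at h
      simp [h] at hpos
    · rw [hov₁]; simp [down, hj.symm]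
    · rw [hov₁]; simp [down, root, side_ne_zero]
  have hmov₂ : Movable G₂ (up v) (Sum.inr (v, i)) (Sum.inr (par v, j)) := by
    obtain ⟨h1, h2, h3, h4, h5⟩ := hmov
    rw [hov] at h1 h4 h5
    exact ⟨by rwa [hov₂], h2, h3, by rwa [hov₂], by rwa [hov₂]⟩
  obtain ⟨G₃, hc₃⟩ := hmov₂.exists_isConj
  refine ⟨G₃, ?_, ?_⟩
  · have := (hc₁.trans hc₂).trans hc₃
    rwa [← mul_assoc, swap_comm (Sum.inr (v, i)) (Sum.inr (par v, j)),
      swap_comm (Sum.inr (par v, j)) root, swap_mul_swap_mul_swap] at this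
    · simp [root, hj0.symm]
    · simp [root, hi.symm]
  · have hlog : Nat.log 2 (v.1 + 1) = Nat.log 2 ((par v).1 + 1) + 1 := by
      rw [Nat.log_of_one_lt_of_le one_lt_two (by omega)]
      congr 2
      simp only [par]; omega
    refine (((Within.of_move (whiteheadMove_iff.2 ⟨_, _, _, hmov, hc₁⟩)).trans hw₂).trans
      (Within.of_move (whiteheadMove_iff.2 ⟨_, _, _, hmov₂, hc₃⟩))).mono ?_
    omega

/-- The half-edges at the first `k` trivalent vertices that are not part of the tree. -/
structure IsSlot (k : ℕ) (x : HalfEdge p m) : Prop where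
  ex : ∃ v : Fin m, ∃ i, x = Sum.inr (v, i) ∧ v.1 < k
  ne_up : ∀ v : Fin m, 0 < v.1 → v.1 < k → x ≠ up v
  ne_down : ∀ v : Fin m, 0 < v.1 → v.1 < k → x ≠ down v

theorem isSlot_root [NeZero m] {k : ℕ} (hk : 0 < k) : IsSlot k (root : HalfEdge p m) := by
  refine ⟨⟨0, 0, rfl, by simpa⟩, fun v hv _ h => ?_, fun v hv _ h => ?_⟩
  · simp only [root, up, Sum.inr.injEq, Prod.mk.injEq, and_true] at h
    subst h; simp at hv
  · simp only [root, down, Sum.inr.injEq, Prod.mk.injEq] at h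
    exact side_ne_zero v h.2.symm

theorem HeapPrefix.conj {G G' : MarkedGraph p m} {k : ℕ} (h : HeapPrefix G k)
    {x y : HalfEdge p m} (hx : IsSlot k x) (hy : IsSlot k y) (hc : IsConj G (swap x y) G') :
    HeapPrefix G' k := fun v h0 hk => by
  have hv := h v h0 hk
  rw [hc.apply_of_ne (hx.ne_up v h0 hk).symm (hy.ne_up v h0 hk).symm, hv]
  · rw [hv]; exact (hx.ne_down v h0 hk).symm
  · rw [hv]; exact (hy.ne_down v h0 hk).symm

theorem HeapPrefix.exists_swap_root [NeZero m] {G : MarkedGraph p m} {k : ℕ}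
    (h : HeapPrefix G k) {x : HalfEdge p m} (hx : IsSlot k x) :
    ∃ G', IsConj G (swap x root) G' ∧ Within (2 * Nat.log 2 m) G G' := by
  obtain ⟨v, i, rfl, hv⟩ := hx.ex
  by_cases hi : i = 0
  · subst hi
    have h0 : v = 0 := by
      by_contra h0
      exact hx.ne_up v (Nat.pos_of_ne_zero fun h => h0 (by ext; simpa using h)) hv rfl
    subst h0
    exact ⟨G, fun x => by simp [root], (Within.refl G).mono (Nat.zero_le _)⟩
  · obtain ⟨G', h1, h2⟩ := RootPath.exists_swap_root G v i (h.rootPath hv) hi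
    exact ⟨G', h1, h2.mono (Nat.mul_le_mul_left _ (Nat.log_mono_right (by omega)))⟩

/-- Two half-edges outside the tree can be exchanged at logarithmic cost. -/
theorem HeapPrefix.exists_swap [NeZero m] {G : MarkedGraph p m} {k : ℕ}
    (h : HeapPrefix G k) {x y : HalfEdge p m} (hx : IsSlot k x) (hy : IsSlot k y) :
    ∃ G', IsConj G (swap x y) G' ∧ Within (6 * Nat.log 2 m) G G' ∧ HeapPrefix G' k := by
  suffices H : ∃ G', IsConj G (swap x y) G' ∧ Within (6 * Nat.log 2 m) G G' by
    obtain ⟨G', h1, h2⟩ := H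
    exact ⟨G', h1, h2, h.conj hx hy h1⟩
  have hk : 0 < k := by obtain ⟨v, i, -, hv⟩ := hx.ex; omega
  by_cases hxy : x = y
  · subst hxy
    exact ⟨G, fun x => by simp, (Within.refl G).mono (Nat.zero_le _)⟩
  obtain ⟨G₁, hc₁, hw₁⟩ := h.exists_swap_root hx
  by_cases hyr : y = root
  · subst hyr
    exact ⟨G₁, hc₁, hw₁.mono (by omega)⟩
  have h₁ := h.conj hx (isSlot_root hk) hc₁
  obtain ⟨G₂, hc₂, hw₂⟩ := h₁.exists_swap_root hy
  have h₂ := h₁.conj hy (isSlot_root hk) hc₂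
  obtain ⟨G₃, hc₃, hw₃⟩ := h₂.exists_swap_root hx
  by_cases hxr : x = root
  · subst hxr
    refine ⟨G₂, ?_, (hw₁.trans hw₂).mono (by omega)⟩
    have := hc₁.trans hc₂
    rwa [swap_self, swap_comm, ← Perm.one_def, mul_one] at this
  refine ⟨G₃, ?_, ((hw₁.trans hw₂).trans hw₃).mono (by omega)⟩
  have := (hc₁.trans hc₂).trans hc₃
  rwa [← mul_assoc, swap_comm x root, swap_mul_swap_mul_swap hyr (Ne.symm hxy)] at this

/-! ### The upper bound -/

theorem HeapPrefix.opp_down {G : MarkedGraph p m} {k : ℕ} (h : HeapPrefix G k) {v : Fin m}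
    (h0 : 0 < v.1) (hk : v.1 < k) : G.opp (down v) = up v := by
  rw [← h v h0 hk, G.opp_opp]

theorem opp_inl [NeZero m] (G : MarkedGraph p m) (i : Fin p) :
    ∃ y, G.opp (Sum.inl i) = Sum.inr y := by
  rcases hy : G.opp (Sum.inl i) with j | y
  · exfalso
    have hj : G.opp (Sum.inl j) = Sum.inl i := by rw [← hy, G.opp_opp]
    have := G.forall_of_closed (fun u => u = Sum.inl i ∨ u = Sum.inl j) (fun x hx => ?_)
      (u := Sum.inl i) (Or.inl rfl) (Sum.inr 0)
    · simp at this
    · rcases x with x | x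
      · simp only [vert, Sum.map_inl, id, Sum.inl.injEq] at hx
        rcases hx with rfl | rfl
        · simp [hy, vert]
        · simp [hj, vert]
      · simp [vert] at hx
  · exact ⟨y, rfl⟩

/-- As the graph is connected, some half-edge leads out of an incomplete tree. -/
theorem HeapPrefix.exists_exit [NeZero m] {G : MarkedGraph p m} {k : ℕ} (h : HeapPrefix G k)
    (hk : 0 < k) (hkm : k < m) :
    ∃ (x : HalfEdge p m) (w : Fin m) (l : Fin 3), IsSlot k x ∧ k ≤ w.1 ∧
      G.opp x = Sum.inr (w, l) := by
  by_contra! hcon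
  -- The vertices of the tree and the marked vertices next to it form a component.
  let f : Vertex p m → Prop := fun u => u.elim
    (fun i => ∃ j : Fin m, j.1 < k ∧ vert (G.opp (Sum.inl i)) = Sum.inr j) (fun j => j.1 < k)
  have hf : ∀ x, f (vert x) → f (vert (G.opp x)) := by
    rintro (i | ⟨j, l⟩) hx
    · obtain ⟨j, hj, hj'⟩ := hx
      change vert (G.opp (Sum.inl i)) = _ at hj'
      rw [hj']; exact hj
    · change j.1 < k at hx
      rcases hy : G.opp (Sum.inr (j, l)) with i | ⟨w, l'⟩
      · refine ⟨j, hx, ?_⟩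
        change vert (G.opp (Sum.inl i)) = _
        rw [← hy, G.opp_opp]; rfl
      · change w.1 < k
        by_contra hw
        refine hcon (Sum.inr (j, l)) w l' ⟨⟨j, l, rfl, hx⟩, fun v h0 hv hv' => ?_,
          fun v h0 hv hv' => ?_⟩ (not_lt.1 hw) hy
        · rw [hv', h v h0 hv] at hy
          simp only [down, Sum.inr.injEq, Prod.mk.injEq] at hy
          have := par_lt h0
          rw [hy.1] at this
          omega
        · rw [hv', h.opp_down h0 hv] at hy
          simp only [up, Sum.inr.injEq, Prod.mk.injEq] at hy
          rw [← hy.1] at hw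
          omega
  have := G.forall_of_closed f hf (u := Sum.inr 0) (by simpa [f] using hk) (Sum.inr ⟨k, hkm⟩)
  simp [f] at this

theorem isSlot_down {k : ℕ} (hk : 0 < k) (hkm : k < m) :
    IsSlot k (down ⟨k, hkm⟩ : HalfEdge p m) := by
  refine ⟨⟨_, _, rfl, par_lt (v := ⟨k, hkm⟩) hk⟩, fun v _ _ h => ?_, fun v h0 hv h => ?_⟩
  · simp only [up, down, Sum.inr.injEq, Prod.mk.injEq] at h
    exact side_ne_zero _ h.2
  · simp only [down, Sum.inr.injEq, Prod.mk.injEq] at h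
    have := eq_of_par_eq_of_side_eq (v := ⟨k, hkm⟩) hk h0 h.1 h.2
    rw [← this] at hv
    exact lt_irrefl _ hv

/-- The tree in heap order can be extended by one vertex at logarithmic cost: a half-edge that
leads out of the tree is moved to the place where the new vertex is to be attached. -/
theorem HeapPrefix.exists_succ [NeZero m] {G : MarkedGraph p m} {k : ℕ} (h : HeapPrefix G k)
    (hk : 0 < k) (hkm : k < m) :
    ∃ G', HeapPrefix G' (k + 1) ∧ Within (6 * Nat.log 2 m) G G' := by
  obtain ⟨x, w, l, hx, hw, hxw⟩ := h.exists_exit hk hkm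
  set K : Fin m := ⟨k, hkm⟩ with hK
  obtain ⟨G₁, hc₁, hw₁, h₁⟩ := h.exists_swap hx (isSlot_down hk hkm)
  have hout : ∀ y : HalfEdge p m, IsSlot k y → Sum.inr (w, l) ≠ y := by
    rintro y hy rfl
    obtain ⟨v, i, hv, hv'⟩ := hy.ex
    simp only [Sum.inr.injEq, Prod.mk.injEq] at hv
    rw [← hv.1] at hv'
    omega
  have hq : G₁.opp (down K) = Sum.inr (w, l) := by
    rw [hc₁.apply_swap, swap_apply_right, hxw,
      swap_apply_of_ne_of_ne (hout _ hx) (hout _ (isSlot_down hk hkm))]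
  -- The vertex `w` is renamed to `K`, and its half-edge `l` to `0`.
  let ρ : Perm (HalfEdge p m) := sumCongr (Equiv.refl _) (prodCongr (swap w K) (Equiv.refl _))
  let τ : Perm (Vertex p m) := sumCongr (Equiv.refl _) (swap w K)
  have hρ : ∀ x, vert (ρ x) = τ (vert x) := by rintro (i | ⟨j, i⟩) <;> rfl
  set s : Perm (HalfEdge p m) := swap (Sum.inr (w, l)) (Sum.inr (w, 0)) with hs
  obtain ⟨G₂, hc₂, hi₂⟩ := exists_isConj_iso G₁ (s := ρ * s) (τ := τ) (fun _ => rfl)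
    (fun x => by rw [Perm.mul_apply, hρ, hs,
      vert_swap (a := Sum.inr (w, l)) (b := Sum.inr (w, 0)) rfl])
  -- The renaming does not affect the vertices of the tree.
  have hfix : ∀ (v : Fin m) (i : Fin 3), v.1 < k → (ρ * s) (Sum.inr (v, i)) = Sum.inr (v, i) := by
    intro v i hv
    have hvw : v ≠ w := by rintro rfl; omega
    have hvK : v ≠ K := by rintro rfl; exact lt_irrefl _ hv
    rw [Perm.mul_apply, hs, swap_apply_of_ne_of_ne (by simp [hvw]) (by simp [hvw])]
    simp [ρ, swap_apply_of_ne_of_ne hvw hvK]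
  have hK0 : (ρ * s) (Sum.inr (w, l)) = up K := by
    rw [Perm.mul_apply, hs, swap_apply_left]
    simp [ρ, up]
  refine ⟨G₂, fun v h0 hv => ?_, (hw₁.trans (Within.of_iso hi₂)).mono (by omega)⟩
  rcases Nat.lt_succ_iff_lt_or_eq.1 hv with hv | hv
  · have := hc₂ (up v)
    rwa [h₁ v h0 hv, up, down, hfix v _ hv, hfix _ _ ((par_lt h0).trans hv)] at this
  · have hvK : v = K := Fin.ext hv
    rw [hvK] at h0 ⊢
    have := hc₂ (down K)
    rw [hq, hK0, down, hfix _ _ (par_lt h0)] at this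
    rw [← this, G₂.opp_opp, down]

theorem exists_heapPrefix [NeZero m] (G : MarkedGraph p m) :
    ∃ G', HeapPrefix G' m ∧ Within (6 * Nat.log 2 m * m) G G' := by
  suffices H : ∀ k < m, ∃ G', HeapPrefix G' (k + 1) ∧ Within (6 * Nat.log 2 m * k) G G' by
    have hm := NeZero.pos m
    obtain ⟨G', h1, h2⟩ := H (m - 1) (by omega)
    rw [Nat.sub_add_cancel hm] at h1
    exact ⟨G', h1, h2.mono (Nat.mul_le_mul_left _ (by omega))⟩
  intro k
  induction k with
  | zero => exact fun _ => ⟨G, fun v h0 hv => by omega, Within.refl G⟩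
  | succ k ih =>
    intro hk
    obtain ⟨G₁, h₁, hw₁⟩ := ih (by omega)
    obtain ⟨G₂, h₂, hw₂⟩ := h₁.exists_succ (by omega) hk
    exact ⟨G₂, h₂, hw₁.trans hw₂⟩

/-- Among graphs that contain the complete tree, each exchange of two half-edges outside the tree
can be made to correct a half-edge that is paired differently in `G` and in `H`. -/
theorem HeapPrefix.within [NeZero m] {G H : MarkedGraph p m} (hG : HeapPrefix G m)
    (hH : HeapPrefix H m) :
    Within (6 * Nat.log 2 m * (Finset.univ.filter fun x => G.opp x ≠ H.opp x).card) G H := by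
  induction hn : (Finset.univ.filter fun x => G.opp x ≠ H.opp x).card using
    Nat.strong_induction_on generalizing G with
  | _ n ih =>
  subst hn
  by_cases hGH : ∀ x, G.opp x = H.opp x
  · have : G = H := by ext1; exact funext hGH
    subst this
    exact (Within.refl G).mono (Nat.zero_le _)
  have hslot : ∀ y, G.opp (Sum.inr y) ≠ H.opp (Sum.inr y) →
      IsSlot m (Sum.inr y : HalfEdge p m) := by
    intro y hy
    refine ⟨⟨y.1, y.2, rfl, y.1.2⟩, fun v h0 hv h => hy ?_, fun v h0 hv h => hy ?_⟩
    · rw [h, hG v h0 hv, hH v h0 hv]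
    · rw [h, hG.opp_down h0 hv, hH.opp_down h0 hv]
  have hne : ∀ x, G.opp x ≠ H.opp x → G.opp (G.opp x) ≠ H.opp (G.opp x) ∧
      G.opp (H.opp x) ≠ H.opp (H.opp x) := by
    intro x hx
    constructor
    · intro h; apply hx; rw [← H.opp_opp (G.opp x), ← h, G.opp_opp]
    · intro h; apply hx; rw [← G.opp_opp (H.opp x), h, H.opp_opp]
  -- Marked vertices are treated first, as only half-edges at trivalent vertices can be moved.
  obtain ⟨x, y, z, hx, hy, hz⟩ : ∃ x y z, G.opp x ≠ H.opp x ∧ G.opp x = Sum.inr y ∧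
      H.opp x = Sum.inr z := by
    push Not at hGH
    by_cases hinl : ∃ i : Fin p, G.opp (Sum.inl i) ≠ H.opp (Sum.inl i)
    · obtain ⟨i, hi⟩ := hinl
      obtain ⟨y, hy⟩ := opp_inl G i
      obtain ⟨z, hz⟩ := opp_inl H i
      exact ⟨_, y, z, hi, hy, hz⟩
    · push Not at hinl
      obtain ⟨x, hx⟩ := hGH
      obtain ⟨h1, h2⟩ := hne x hx
      refine ⟨x, ?_⟩
      rcases hy : G.opp x with i | y
      · exact absurd (hinl i) (by rwa [hy] at h1)
      rcases hz : H.opp x with i | z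
      · exact absurd (hinl i) (by rwa [hz] at h2)
      exact ⟨y, z, by rwa [hy, hz] at hx, rfl, rfl⟩
  obtain ⟨hy', hz'⟩ := hne x hx
  rw [hy] at hy'
  rw [hz] at hz'
  obtain ⟨G', hc, hw, hG'⟩ := hG.exists_swap (hslot y hy') (hslot z hz')
  have hyz : (Sum.inr y : HalfEdge p m) ≠ Sum.inr z := by rwa [hy, hz] at hx
  have hyx : x ≠ Sum.inr y := fun h => G.opp_ne x (by rw [hy, h])
  have hzx : x ≠ Sum.inr z := fun h => H.opp_ne x (by rw [hz, h])
  have hG'x : G'.opp x = H.opp x := by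
    rw [hc.apply_swap, swap_apply_of_ne_of_ne hyx hzx, hy, swap_apply_left, hz]
  have hlt : (Finset.univ.filter fun x => G'.opp x ≠ H.opp x).card <
      (Finset.univ.filter fun x => G.opp x ≠ H.opp x).card := by
    refine Finset.card_lt_card (Finset.ssubset_iff_of_subset ?_ |>.2 ⟨x, by simpa using hx,
      by simpa using hG'x⟩)
    intro t ht
    simp only [Finset.mem_filter, Finset.mem_univ, true_and] at ht ⊢
    intro hGt
    by_cases h1 : t = Sum.inr y
    · exact hy' (h1 ▸ hGt)
    by_cases h2 : t = Sum.inr z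
    · exact hz' (h2 ▸ hGt)
    refine ht ?_
    rw [hc.apply_of_ne h1 h2, hGt]
    · intro h3
      apply hx
      have : t = x := by rw [← G.opp_opp t, h3, ← hy, G.opp_opp]
      exact this ▸ hGt
    · intro h3
      apply hx
      have : t = x := by rw [← H.opp_opp t, ← hGt, h3, ← hz, H.opp_opp]
      exact this ▸ hGt
  refine (hw.trans (ih _ hlt hG' rfl)).mono ?_
  rw [← mul_one_add]
  exact Nat.mul_le_mul_left _ (by omega)

/-- Any two graphs are joined by `O((m + p) log m)` Whitehead moves. -/
theorem within_of_neZero [NeZero m] (G H : MarkedGraph p m) :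
    Within (6 * Nat.log 2 m * (5 * m + p)) G H := by
  obtain ⟨G', hG, hGw⟩ := exists_heapPrefix G
  obtain ⟨H', hH, hHw⟩ := exists_heapPrefix H
  refine ((hGw.trans (hG.within hH)).trans hHw.symm).mono ?_
  rw [← mul_add, ← mul_add]
  refine Nat.mul_le_mul_left _ ?_
  have := Finset.card_filter_le (Finset.univ : Finset (HalfEdge p m)) fun x =>
    G'.opp x ≠ H'.opp x
  simp only [Finset.card_univ, Fintype.card_sum, Fintype.card_prod, Fintype.card_fin] at this
  omega

/-! ### Counting the results of sequences of moves -/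

/-- `G'` results from `G` by `k` Whitehead moves, and `L v` is the half-edge at the trivalent
vertex `v` that lies on the edge of the first of these moves in which `v` takes part; it is
`none` if `v` takes part in none of them. -/
inductive Reach : ℕ → MarkedGraph p m → (Fin m → Option (Fin 3)) → MarkedGraph p m → Prop
  | zero (G : MarkedGraph p m) : Reach 0 G (fun _ => none) G
  | succ {k : ℕ} {G G₁ G' : MarkedGraph p m} {L : Fin m → Option (Fin 3)} {u v : Fin m}
      {i j : Fin 3} {a b : HalfEdge p m} (hopp : G.opp (Sum.inr (u, i)) = Sum.inr (v, j))
      (hm : Movable G (Sum.inr (u, i)) a b) (hc : IsConj G (swap a b) G₁)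
      (hr : Reach k G₁ L G') :
      Reach (k + 1) G (Function.update (Function.update L u (some i)) v (some j)) G'

theorem ne_of_vert_ne {a b : HalfEdge p m} (h : vert a ≠ vert b) : a ≠ b := fun hab =>
  h (congrArg vert hab)

theorem Movable.of_opp_eq {G G' : MarkedGraph p m} {h a b : HalfEdge p m} (hm : Movable G h a b)
    (ho : G'.opp h = G.opp h) : Movable G' h a b := by
  obtain ⟨h1, h2, h3, h4, h5⟩ := hm
  exact ⟨by rwa [ho], h2, h3, by rwa [ho], by rwa [ho]⟩

theorem Movable.swap {G : MarkedGraph p m} {h a b : HalfEdge p m} (hm : Movable G h a b) :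
    Movable G (G.opp h) b a := by
  obtain ⟨h1, h2, h3, h4, h5⟩ := hm
  exact ⟨by rw [G.opp_opp]; exact h1.symm, h4, h5, by rwa [G.opp_opp], by rwa [G.opp_opp]⟩

/-- If both ends of an edge take part for the first time in a move on this edge, then this move
may as well be the first one, because the moves before it take place at other vertices. -/
theorem Reach.front {n : ℕ} {G G' : MarkedGraph p m} {L : Fin m → Option (Fin 3)}
    (hr : Reach n G L G') {u v : Fin m} {i j : Fin 3}
    (hopp : G.opp (Sum.inr (u, i)) = Sum.inr (v, j)) (huv : u ≠ v) (hu : L u = some i)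
    (hv : L v = some j) :
    ∃ k a b G₁ L₁, n = k + 1 ∧ Movable G (Sum.inr (u, i)) a b ∧ IsConj G (swap a b) G₁ ∧
      Reach k G₁ L₁ G' ∧
      L = Function.update (Function.update L₁ u (some i)) v (some j) := by
  induction hr with
  | zero G => simp at hu
  | @succ k G G₁ G' L u₀ v₀ i₀ j₀ a b hopp₀ hm hc hr ih =>
  have huv₀ : u₀ ≠ v₀ := fun h => hm.ne (by rw [hopp₀]; simp [vert, h])
  have hopp' : G.opp (Sum.inr (v, j)) = Sum.inr (u, i) := by rw [← hopp, G.opp_opp]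
  have hopp₀' : G.opp (Sum.inr (v₀, j₀)) = Sum.inr (u₀, i₀) := by rw [← hopp₀, G.opp_opp]
  by_cases h1 : u = u₀
  · subst h1
    obtain rfl : i₀ = i := by simpa [Function.update_apply, huv₀] using hu
    rw [hopp₀] at hopp
    simp only [Sum.inr.injEq, Prod.mk.injEq] at hopp
    obtain ⟨rfl, rfl⟩ := hopp
    exact ⟨k, a, b, G₁, L, rfl, hm, hc, hr, rfl⟩
  by_cases h2 : u = v₀
  · subst h2
    obtain rfl : j₀ = i := by simpa using hu
    rw [hopp₀'] at hopp
    simp only [Sum.inr.injEq, Prod.mk.injEq] at hopp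
    obtain ⟨rfl, rfl⟩ := hopp
    refine ⟨k, b, a, G₁, L, rfl, ?_, by rwa [swap_comm], hr, Function.update_comm huv.symm _ _ _⟩
    rw [← hopp₀]
    exact hm.swap
  by_cases h3 : v = u₀
  · subst h3
    obtain rfl : i₀ = j := by simpa [Function.update_apply, huv₀] using hv
    rw [hopp₀] at hopp'
    simp only [Sum.inr.injEq, Prod.mk.injEq] at hopp'
    exact absurd hopp'.1.symm h2
  by_cases h4 : v = v₀
  · subst h4
    obtain rfl : j₀ = j := by simpa using hv
    rw [hopp₀'] at hopp'
    simp only [Sum.inr.injEq, Prod.mk.injEq] at hopp'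
    exact absurd hopp'.1.symm h1
  -- The edge of the first move is disjoint from the given one.
  have va : vert a = Sum.inr u₀ := hm.va
  have vb : vert b = Sum.inr v₀ := by rw [hm.vb, hopp₀]; rfl
  have hopp₁ : G₁.opp (Sum.inr (u, i)) = Sum.inr (v, j) := by
    rw [hc.apply_of_ne, hopp] <;> first | rw [hopp] | skip
    all_goals
      apply ne_of_vert_ne
      simp [va, vb, h1, h2, h3, h4]
  obtain ⟨k', a', b', G₂, L₂, rfl, hm', hc', hr', hL⟩ := ih hopp₁
    (by simpa [Function.update_apply, h1, h2] using hu)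
    (by simpa [Function.update_apply, h3, h4] using hv)
  have hmG : Movable G (Sum.inr (u, i)) a' b' := hm'.of_opp_eq (by rw [hopp, hopp₁])
  obtain ⟨G₃, hc₃⟩ := hmG.exists_isConj
  have va' : vert a' = Sum.inr u := hm'.va
  have vb' : vert b' = Sum.inr v := by rw [hm'.vb, hopp₁]; rfl
  have hopp₃ : G₃.opp (Sum.inr (u₀, i₀)) = Sum.inr (v₀, j₀) := by
    rw [hc₃.apply_of_ne, hopp₀] <;> first | rw [hopp₀] | skip
    all_goals
      apply ne_of_vert_ne
      simp [va', vb', Ne.symm h1, Ne.symm h2, Ne.symm h3, Ne.symm h4]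
  have hm₃ : Movable G₃ (Sum.inr (u₀, i₀)) a b := hm.of_opp_eq (by rw [hopp₀, hopp₃])
  have hc₄ : IsConj G₃ (swap a b) G₂ := by
    obtain ⟨G₄, hc₄⟩ := hm₃.exists_isConj
    have hcomm : swap a' b' * swap a b = swap a b * swap a' b' := by
      refine (Perm.disjoint_swap_swap ?_).commute
      have e1 : a' ≠ b' := ne_of_vert_ne (by simp [va', vb', huv])
      have e2 : a' ≠ a := ne_of_vert_ne (by simp [va', va, h1])
      have e3 : a' ≠ b := ne_of_vert_ne (by simp [va', vb, h2])
      have e4 : b' ≠ a := ne_of_vert_ne (by simp [vb', va, h3])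
      have e5 : b' ≠ b := ne_of_vert_ne (by simp [vb', vb, h4])
      have e6 : a ≠ b := ne_of_vert_ne (by simp [va, vb, huv₀])
      simp [e1, e2, e3, e4, e5, e6]
    have h5 := hc.trans hc'
    rw [hcomm] at h5
    rwa [h5.unique (hc₃.trans hc₄)]
  refine ⟨k' + 1, a', b', G₃, _, rfl, hmG, hc₃, .succ hopp₃ hm₃ hc₄ hr', ?_⟩
  rw [hL, Function.update_comm h3, Function.update_comm h4, Function.update_comm h1,
    Function.update_comm h2]

instance : Finite (MarkedGraph p m) :=
  Finite.of_injective MarkedGraph.opp fun _ _ h => MarkedGraph.ext h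

/-- The first moves at each vertex determine which edges are ready for a move, and such a move may
be performed at once. So a move costs only a bounded amount of information: the pair of
half-edges that it exchanges, and the next use of the two vertices. -/
theorem Reach.ncard_le (k : ℕ) (G : MarkedGraph p m) (L : Fin m → Option (Fin 3)) :
    {G' | Reach k G L G'}.ncard ≤ 144 ^ k := by
  induction k generalizing G L with
  | zero =>
    rw [pow_zero, Set.ncard_le_one_iff]
    rintro a b ⟨⟩ ⟨⟩
    rfl
  | succ k ih =>
    by_cases hne : ∃ G', Reach (k + 1) G L G'
    swap
    · push Not at hne
      simp [hne]
    obtain ⟨u, v, i, j, hopp, huv, hu, hv⟩ : ∃ u v i j,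
        G.opp (Sum.inr (u, i)) = Sum.inr (v, j) ∧ u ≠ v ∧ L u = some i ∧ L v = some j := by
      obtain ⟨G', hr⟩ := hne
      cases hr with
      | @succ _ _ _ _ L u v i j a b hopp hm hc hr =>
      have huv : u ≠ v := fun h => hm.ne (by rw [hopp]; simp [vert, h])
      exact ⟨u, v, i, j, hopp, huv, by simp [huv], by simp⟩
    let S : Fin 3 × Fin 3 × Option (Fin 3) × Option (Fin 3) → Set (MarkedGraph p m) :=
      fun c => {G' | ∃ G₁, IsConj G (swap (Sum.inr (u, c.1)) (Sum.inr (v, c.2.1))) G₁ ∧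
        Reach k G₁ (Function.update (Function.update L u c.2.2.1) v c.2.2.2) G'}
    have hS : ∀ c, (S c).ncard ≤ 144 ^ k := by
      intro c
      by_cases hc : ∃ G₁, IsConj G (swap (Sum.inr (u, c.1)) (Sum.inr (v, c.2.1))) G₁
      · obtain ⟨G₁, hG₁⟩ := hc
        refine (Set.ncard_le_ncard ?_ (Set.toFinite _)).trans
          (ih G₁ (Function.update (Function.update L u c.2.2.1) v c.2.2.2))
        rintro G' ⟨G₂, hG₂, hr⟩
        rwa [hG₂.unique hG₁] at hr
      · push Not at hc
        simp [S, hc]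
    have hsub : {G' | Reach (k + 1) G L G'} ⊆ ⋃ c, S c := by
      intro G' hr
      obtain ⟨k', a, b, G₁, L₁, hk, hm, hc, hr', hL⟩ := Reach.front hr hopp huv hu hv
      obtain rfl : k = k' := by omega
      have va : vert a = Sum.inr u := hm.va
      have vb : vert b = Sum.inr v := by rw [hm.vb, hopp]; rfl
      obtain ⟨α, rfl⟩ : ∃ α, a = Sum.inr (u, α) := by
        rcases a with a | ⟨a, α⟩ <;> simp [vert] at va
        exact ⟨α, by rw [va]⟩
      obtain ⟨β, rfl⟩ : ∃ β, b = Sum.inr (v, β) := by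
        rcases b with b | ⟨b, β⟩ <;> simp [vert] at vb
        exact ⟨β, by rw [vb]⟩
      refine Set.mem_iUnion.2 ⟨(α, β, L₁ u, L₁ v), G₁, hc, ?_⟩
      convert hr'
      funext x
      by_cases hxv : x = v
      · simp [hxv]
      by_cases hxu : x = u
      · simp [hxu, huv]
      simp [hL, hxu, hxv]
    calc {G' | Reach (k + 1) G L G'}.ncard ≤ (⋃ c, S c).ncard :=
          Set.ncard_le_ncard hsub (Set.toFinite _)
      _ ≤ ∑ c, (S c).ncard := Set.ncard_iUnion_le_of_fintype _
      _ ≤ ∑ _ : Fin 3 × Fin 3 × Option (Fin 3) × Option (Fin 3), 144 ^ k :=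
          Finset.sum_le_sum fun c _ => hS c
      _ = 144 ^ (k + 1) := by
          simp only [Finset.sum_const, Finset.card_univ, Fintype.card_prod, Fintype.card_option,
            Fintype.card_fin, smul_eq_mul, pow_succ]
          ring

/-- A Whitehead move can be carried over along an isomorphism. -/
theorem exists_whiteheadMove_of_iso {G H G₁ : MarkedGraph p m} (hi : G.Iso H)
    (hm : G.WhiteheadMove G₁) : ∃ H₁, H.WhiteheadMove H₁ ∧ G₁.Iso H₁ := by
  obtain ⟨σ, τ, h1, h2, h3⟩ := hi
  obtain ⟨h, a, b, ⟨m1, m2, m3, m4, m5⟩, hc⟩ := whiteheadMove_iff.1 hm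
  have hmH : Movable H (σ h) (σ a) (σ b) := by
    refine ⟨?_, by simpa using m2, by rw [h2, h2, m3], ?_, ?_⟩
    · rw [← h3, h2, h2]; simpa using m1
    · rw [← h3]; simpa using m4
    · rw [← h3, h2, h2, m5]
  obtain ⟨H₁, hH₁⟩ := hmH.exists_isConj
  refine ⟨H₁, whiteheadMove_iff.2 ⟨_, _, _, hmH, hH₁⟩, σ, τ, h1, h2, fun x => ?_⟩
  rw [hH₁.apply_swap, hc.apply_swap, σ.injective.swap_apply, ← h3, σ.injective.swap_apply]

theorem Reach.of_move {k : ℕ} {G G₁ G' : MarkedGraph p m} {L : Fin m → Option (Fin 3)}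
    (hm : G.WhiteheadMove G₁) (hr : Reach k G₁ L G') : ∃ L', Reach (k + 1) G L' G' := by
  obtain ⟨h, a, b, hm, hc⟩ := whiteheadMove_iff.1 hm
  obtain ⟨-, m2, m3, m4, m5⟩ := id hm
  rcases h with h | ⟨u, i⟩
  · rcases a with a | a <;> simp [vert] at m2 m3
    exact absurd m3 m2
  rcases hopp : G.opp (Sum.inr (u, i)) with h | ⟨v, j⟩
  · rw [hopp] at m4 m5
    rcases b with b | b <;> simp [vert] at m4 m5
    exact absurd m5 m4
  exact ⟨_, .succ hopp hm hc hr⟩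

theorem exists_reach_of_walk {x y : Quotient (MarkedGraph.isoSetoid p m)}
    (w : (classGraph p m).Walk x y) (G : MarkedGraph p m) (hG : ⟦G⟧ = x) :
    ∃ L G', Reach w.length G L G' ∧ ⟦G'⟧ = y := by
  induction w generalizing G with
  | nil => exact ⟨_, G, .zero G, hG⟩
  | @cons x y z hxy w ih =>
    subst hG
    have hmove : ∃ H H₁ : MarkedGraph p m, ⟦H⟧ = (⟦G⟧ : Quotient (MarkedGraph.isoSetoid p m)) ∧
        ⟦H₁⟧ = y ∧ H.WhiteheadMove H₁ := by
      rw [classGraph, SimpleGraph.fromRel_adj] at hxy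
      obtain ⟨-, h | ⟨H, H₁, h1, h2, h3⟩⟩ := hxy
      · exact h
      · exact ⟨H₁, H, h2, h1, whiteheadMove_symm h3⟩
    obtain ⟨H, H₁, h1, h2, h3⟩ := hmove
    obtain ⟨G₁, hm, hi⟩ := exists_whiteheadMove_of_iso (Quotient.exact h1) h3
    obtain ⟨L, G', hr, hG'⟩ := ih G₁ (by rw [← h2]; exact (Quotient.sound hi).symm)
    obtain ⟨L', hr'⟩ := hr.of_move hm
    exact ⟨L', G', hr', hG'⟩

/-- If all distances from `G` are at most `D`, then there are at most `2 ^ O(m + D)` classes. -/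
theorem card_classes_le (G : MarkedGraph p m) (D : ℕ)
    (hD : ∀ y, ∃ w : (classGraph p m).Walk ⟦G⟧ y, w.length ≤ D) :
    Nat.card (Quotient (MarkedGraph.isoSetoid p m)) ≤ (D + 1) * 4 ^ m * 144 ^ D := by
  let S : Fin (D + 1) × (Fin m → Option (Fin 3)) → Set (MarkedGraph p m) :=
    fun c => {G' | Reach c.1 G c.2 G'}
  have hS : (⋃ c, S c).ncard ≤ (D + 1) * 4 ^ m * 144 ^ D := by
    calc (⋃ c, S c).ncard ≤ ∑ c, (S c).ncard := Set.ncard_iUnion_le_of_fintype _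
      _ ≤ ∑ _ : Fin (D + 1) × (Fin m → Option (Fin 3)), 144 ^ D :=
          Finset.sum_le_sum fun c _ => (Reach.ncard_le _ _ _).trans
            (Nat.pow_le_pow_right (by norm_num) (by omega))
      _ = (D + 1) * 4 ^ m * 144 ^ D := by simp
  refine le_trans ?_ hS
  rw [← Nat.card_coe_set_eq]
  refine Nat.card_le_card_of_surjective
    (fun x : (⋃ c, S c : Set (MarkedGraph p m)) => (⟦x.1⟧ : Quotient (MarkedGraph.isoSetoid p m)))
    fun y => ?_
  obtain ⟨w, hw⟩ := hD y
  obtain ⟨L, G', hr, hG'⟩ := exists_reach_of_walk w G rfl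
  exact ⟨⟨G', Set.mem_iUnion.2 ⟨(⟨w.length, by omega⟩, L), hr⟩⟩, hG'⟩

/-! ### Many graphs with the same spanning tree -/

/-- An enumeration of the half-edges that are not part of the complete tree in heap order: those
that would lead to the vertices `m, …, 2m` of a larger tree, and the one at the root. -/
def slotAt [NeZero m] (t : Fin (m + 2)) : HalfEdge p m :=
  if h : t.1 ≤ m then
    Sum.inr (⟨(m + t.1 - 1) / 2, by have := NeZero.pos m; omega⟩, if (m + t.1) % 2 = 1 then 1 else 2)
  else root

/-- The two halves of the edges of a graph with the tree in heap order: the summands stand for the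
edges at the marked vertices, the edges of the tree, and the remaining `g` edges. The
enumeration `e` says how the edges outside the tree are attached to it. -/
def halves [NeZero m] (e : (Fin p ⊕ Fin g) ⊕ Fin g ≃ Fin (m + 2)) :
    (Fin p ⊕ {v : Fin m // 0 < v.1} ⊕ Fin g) ⊕ (Fin p ⊕ {v : Fin m // 0 < v.1} ⊕ Fin g) →
      HalfEdge p m
  | .inl (.inl i) => Sum.inl i
  | .inl (.inr (.inl v)) => up v
  | .inl (.inr (.inr i)) => slotAt (e (.inr i))
  | .inr (.inl i) => slotAt (e (.inl (.inl i)))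
  | .inr (.inr (.inl v)) => down v
  | .inr (.inr (.inr i)) => slotAt (e (.inl (.inr i)))

theorem eq_zero_of_not_pos [NeZero m] {v : Fin m} (hv : ¬ 0 < v.1) : v = 0 := by
  ext
  simpa using hv

theorem slotAt_injective [NeZero m] : Function.Injective (slotAt : Fin (m + 2) → HalfEdge p m) := by
  intro s t h
  have hm := NeZero.pos m
  ext
  have hside : ∀ n : ℕ, (if n % 2 = 1 then 1 else 2 : Fin 3) ≠ 0 := fun n => by
    split <;> decide
  by_cases hs : s.1 ≤ m <;> by_cases ht : t.1 ≤ m <;>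
    simp only [slotAt, hs, ht, dite_true, dite_false, root, Sum.inr.injEq, Prod.mk.injEq,
      Fin.mk.injEq] at h
  · obtain ⟨h1, h2⟩ := h
    split at h2 <;> split at h2 <;> omega
  · exact absurd h.2 (hside _)
  · exact absurd h.2.symm (hside _)
  · omega

theorem slotAt_ne_inl [NeZero m] (t : Fin (m + 2)) (i : Fin p) :
    (slotAt t : HalfEdge p m) ≠ Sum.inl i := by
  unfold slotAt root
  split <;> simp

theorem slotAt_ne_up [NeZero m] (t : Fin (m + 2)) {v : Fin m} (hv : 0 < v.1) :
    (slotAt t : HalfEdge p m) ≠ up v := by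
  unfold slotAt root up
  split <;> intro h <;> simp only [Sum.inr.injEq, Prod.mk.injEq] at h <;> obtain ⟨h1, h2⟩ := h
  · split at h2 <;> exact absurd h2 (by decide)
  · simp [← h1] at hv

theorem slotAt_ne_down [NeZero m] (t : Fin (m + 2)) {v : Fin m} (hv : 0 < v.1) :
    (slotAt t : HalfEdge p m) ≠ down v := by
  unfold slotAt root down
  split <;> intro h <;> simp only [Sum.inr.injEq, Prod.mk.injEq] at h <;> obtain ⟨h1, h2⟩ := h
  · simp only [par, side, Fin.mk.injEq] at h1 h2
    split at h2 <;> split at h2 <;> omega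
  · exact side_ne_zero v h2.symm

theorem up_ne_down (v w : Fin m) : (up v : HalfEdge p m) ≠ down w := fun h => by
  simp only [up, down, Sum.inr.injEq, Prod.mk.injEq] at h
  exact side_ne_zero w h.2.symm

theorem eq_down_or_slotAt [NeZero m] (v : Fin m) (i : Fin 3) (hi : i ≠ 0) :
    (∃ w : Fin m, 0 < w.1 ∧ (Sum.inr (v, i) : HalfEdge p m) = down w) ∨
      ∃ t, (Sum.inr (v, i) : HalfEdge p m) = slotAt t := by
  have hi0 : 0 < i.1 := Nat.pos_of_ne_zero fun h => hi (Fin.ext h)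
  have hi2 := i.2
  have key : ∀ n : ℕ, n = 2 * v.1 + i.1 → i = if n % 2 = 1 then 1 else 2 := by
    intro n hn
    ext
    split <;> simp <;> omega
  by_cases h : 2 * v.1 + i.1 < m
  · refine Or.inl ⟨⟨2 * v.1 + i.1, h⟩, by simp; omega, ?_⟩
    simp only [down, Sum.inr.injEq, Prod.mk.injEq]
    refine ⟨Fin.ext ?_, key _ rfl⟩
    simp only [par]; omega
  · have hv := v.2
    refine Or.inr ⟨⟨2 * v.1 + i.1 - m, by omega⟩, ?_⟩
    rw [slotAt, dif_pos (by simp only; omega)]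
    simp only [Sum.inr.injEq, Prod.mk.injEq]
    refine ⟨Fin.ext ?_, key _ (by omega)⟩
    simp only; omega

theorem halves_bijective [NeZero m] (e : (Fin p ⊕ Fin g) ⊕ Fin g ≃ Fin (m + 2)) :
    Function.Bijective (halves e) := by
  have hslot : ∀ {a b}, (slotAt (e a) : HalfEdge p m) = slotAt (e b) → a = b := fun h =>
    e.injective (slotAt_injective h)
  constructor
  · rintro ((i | ⟨v, hv⟩ | i) | (i | ⟨v, hv⟩ | i)) ((j | ⟨w, hw⟩ | j) | (j | ⟨w, hw⟩ | j)) h <;>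
      simp only [halves] at h
    all_goals first
      | exact absurd h (slotAt_ne_inl _ _)
      | exact absurd h.symm (slotAt_ne_inl _ _)
      | exact absurd h (slotAt_ne_up _ hw)
      | exact absurd h.symm (slotAt_ne_up _ hv)
      | exact absurd h (slotAt_ne_down _ hw)
      | exact absurd h.symm (slotAt_ne_down _ hv)
      | exact absurd h (up_ne_down _ _)
      | exact absurd h.symm (up_ne_down _ _)
      | (have := hslot h; simp_all)
      | skip
    · simpa using h
    · simp [up] at h
    · simp [down] at h
    · simp [up] at h
    · simpa [up] using h
    · simp [down] at h
    · simp only [down, Sum.inr.injEq, Prod.mk.injEq] at h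
      simpa using eq_of_par_eq_of_side_eq hv hw h.1 h.2
  · have hs : ∀ t, ∃ y, halves e y = slotAt t := fun t => by
      obtain ⟨a, rfl⟩ := e.surjective t
      rcases a with (i | i) | i
      · exact ⟨.inr (.inl i), rfl⟩
      · exact ⟨.inr (.inr (.inr i)), rfl⟩
      · exact ⟨.inl (.inr (.inr i)), rfl⟩
    rintro (i | ⟨v, i⟩)
    · exact ⟨.inl (.inl i), rfl⟩
    · by_cases hi : i = 0
      · subst hi
        by_cases hv : 0 < v.1
        · exact ⟨.inl (.inr (.inl ⟨v, hv⟩)), rfl⟩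
        · obtain ⟨y, hy⟩ := hs ⟨m + 1, by omega⟩
          refine ⟨y, hy.trans ?_⟩
          have : v = 0 := eq_zero_of_not_pos hv
          simp [slotAt, root, this]
      · rcases eq_down_or_slotAt (p := p) v i hi with ⟨w, hw, h⟩ | ⟨t, h⟩
        · exact ⟨.inr (.inr (.inl ⟨w, hw⟩)), h.symm⟩
        · rw [h]
          exact hs t

theorem exists_graph [NeZero m] (e : (Fin p ⊕ Fin g) ⊕ Fin g ≃ Fin (m + 2)) :
    ∃ G : MarkedGraph p m, ∀ y, G.opp (halves e y) = halves e y.swap := by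
  let Ψ := Equiv.ofBijective _ (halves_bijective e)
  have hΨ : ∀ y, Ψ y = halves e y := fun _ => rfl
  have : Nonempty (Vertex p m) := ⟨Sum.inr 0⟩
  have happ : ∀ y, Ψ (Ψ.symm (halves e y)).swap = halves e y.swap := fun y => by
    rw [← hΨ y, Equiv.symm_apply_apply]; rfl
  refine ⟨⟨fun x => Ψ (Ψ.symm x).swap, fun x => by simp, fun x hx => ?_,
    connected_of_forall_closed _ fun f hf => ?_⟩, happ⟩
  · rw [← Equiv.eq_symm_apply] at hx
    rcases h : Ψ.symm x with y | y <;> simp [h] at hx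
  · have hiff : ∀ y, f (vert (halves e y)) ↔ f (vert (halves e y.swap)) := fun y =>
      ⟨fun h => by rw [← happ]; exact hf _ h,
        fun h => by have := hf _ h; rwa [happ, Sum.swap_swap] at this⟩
    have h0 : ∀ n, ∀ v : Fin m, v.1 = n → (f (Sum.inr v) ↔ f (Sum.inr 0)) := by
      intro n
      induction n using Nat.strong_induction_on with
      | _ n ih =>
      rintro v rfl
      by_cases hv : 0 < v.1
      · rw [← ih _ (par_lt hv) (par v) rfl]
        exact hiff (.inl (.inr (.inl ⟨v, hv⟩)))
      · have : v = 0 := eq_zero_of_not_pos hv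
        rw [this]
    have h1 : ∀ u, f u ↔ f (Sum.inr 0) := by
      rintro (i | v)
      · refine (hiff (.inl (.inl i))).trans ?_
        rcases h : halves e (.inr (.inl i)) with j | ⟨v, l⟩
        · exact absurd h (slotAt_ne_inl _ _)
        · rw [Sum.swap_inl, h]; exact h0 _ v rfl
      · exact h0 _ v rfl
    intro u v hu
    rwa [h1, ← h1 u]

theorem heapPrefix_of_halves [NeZero m] {e : (Fin p ⊕ Fin g) ⊕ Fin g ≃ Fin (m + 2)}
    {G : MarkedGraph p m} (h : ∀ y, G.opp (halves e y) = halves e y.swap) : HeapPrefix G m :=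
  fun v hv _ => h (.inl (.inr (.inl ⟨v, hv⟩)))

/-- The position of a half-edge at its vertex. -/
def pos : HalfEdge p m → Fin 3 := Sum.elim (fun _ => 0) Prod.snd

theorem halfEdge_ext {x y : HalfEdge p m} (h : vert x = vert y) (h' : pos x = pos y) : x = y := by
  rcases x with i | ⟨v, i⟩ <;> rcases y with j | ⟨w, j⟩ <;> simp_all [pos]

theorem exists_iso_out (G : MarkedGraph p m) :
    G.Iso (⟦G⟧ : Quotient (MarkedGraph.isoSetoid p m)).out :=
  Setoid.symm (Quotient.mk_out G)

/-- Each isomorphism class contains at most `2 ^ O(p + m)` graphs with the given tree: such a graph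
can be recovered from the isomorphism to a representative of the class, which in turn can be
recovered along the tree from the image of the root and the order of the half-edges at the image
of each vertex. -/
theorem card_heapPrefix_le [NeZero m] :
    Nat.card {G : MarkedGraph p m // HeapPrefix G m} ≤
      Nat.card (Quotient (MarkedGraph.isoSetoid p m)) * ((p + m) * 27 ^ m) := by
  choose σ τ h1 h2 h3 using fun G : MarkedGraph p m => exists_iso_out G
  let Φ : {G : MarkedGraph p m // HeapPrefix G m} → Quotient (MarkedGraph.isoSetoid p m) ×
      Vertex p m × (Fin m × Fin 3 → Fin 3) :=
    fun G => (⟦G.1⟧, vert (σ G.1 root), fun x => pos (σ G.1 (Sum.inr x)))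
  have hΦ : Function.Injective Φ := by
    rintro ⟨G, hG⟩ ⟨H, hH⟩ h
    simp only [Φ, Prod.mk.injEq] at h
    obtain ⟨hq, hr, hp⟩ := h
    have hτ : ∀ n, ∀ v : Fin m, v.1 = n → τ G (Sum.inr v) = τ H (Sum.inr v) := by
      intro n
      induction n using Nat.strong_induction_on with
      | _ n ih =>
      rintro v rfl
      by_cases hv : 0 < v.1
      · have hd : σ G (down v) = σ H (down v) := by
          refine halfEdge_ext ?_ (congrFun hp _)
          rw [h2, h2]
          exact ih _ (par_lt hv) _ rfl
        have hu : σ G (up v) = σ H (up v) := by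
          rw [← hG.opp_down hv v.2, h3, hd, hq, ← h3, hG.opp_down hv v.2, hH.opp_down hv v.2]
        have := congrArg vert hu
        rwa [h2, h2] at this
      · have : v = 0 := eq_zero_of_not_pos hv
        subst this
        rwa [h2, h2] at hr
    have hσ : ∀ x, σ G x = σ H x := by
      rintro (i | x)
      · have hfix : ∀ K : MarkedGraph p m, σ K (Sum.inl i) = Sum.inl i := fun K => by
          have := h2 K (Sum.inl i)
          rw [vert_inl, h1] at this
          rcases hy : σ K (Sum.inl i) with j | ⟨v, l⟩
          · rw [hy] at this; simpa using this
          · rw [hy] at this; simp at this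
        rw [hfix, hfix]
      · refine halfEdge_ext ?_ (congrFun hp _)
        rw [h2, h2]
        exact hτ _ x.1 rfl
    apply Subtype.ext
    ext1
    funext x
    apply (σ G).injective
    rw [h3, hσ (H.opp x), h3, hq, hσ]
  refine (Nat.card_le_card_of_injective Φ hΦ).trans (le_of_eq ?_)
  rw [Nat.card_prod, Nat.card_prod]
  congr 2
  · simp
  · simp [mul_comm m 3, pow_mul]

theorem factorial_le [NeZero m] (hm : m + 2 = 2 * g + p) :
    (g + p).factorial ≤
      Nat.card (Quotient (MarkedGraph.isoSetoid p m)) * ((p + m) * 27 ^ m) := by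
  refine le_trans ?_ card_heapPrefix_le
  let e : (Fin p ⊕ Fin g) ⊕ Fin g ≃ Fin (m + 2) :=
    Fintype.equivOfCardEq (by simp; omega)
  -- While one end of every edge outside the tree is kept in place, the other ends are permuted, and
  -- the resulting graph determines the permutation.
  choose G hG using fun π : Perm (Fin p ⊕ Fin g) =>
    exists_graph ((sumCongr π (Equiv.refl _)).trans e)
  have hcard : Nat.card (Perm (Fin p ⊕ Fin g)) = (g + p).factorial := by
    simp [Fintype.card_perm, add_comm]
  rw [← hcard]
  refine Nat.card_le_card_of_injective (fun π => ⟨G π, heapPrefix_of_halves (hG π)⟩)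
    fun π π' h => ?_
  have hGG : G π = G π' := congrArg Subtype.val h
  refine Equiv.ext fun a => ?_
  suffices H : (slotAt (e (.inl (π a))) : HalfEdge p m) = slotAt (e (.inl (π' a))) from
    Sum.inl_injective (e.injective (slotAt_injective H))
  rcases a with i | i
  · exact (hG π (.inl (.inl i))).symm.trans (hGG ▸ hG π' (.inl (.inl i)))
  · exact (hG π (.inl (.inr (.inr i)))).symm.trans (hGG ▸ hG π' (.inl (.inr (.inr i))))

theorem exists_equiv_apply_eq {α β : Type*} [DecidableEq β] (e : α ≃ β) {a a' : α} {b b' : β}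
    (ha : a ≠ a') (hb : b ≠ b') : ∃ e' : α ≃ β, e' a = b ∧ e' a' = b' := by
  let e₁ := e.trans (swap (e a) b)
  have h1 : e₁ a = b := by simp [e₁]
  refine ⟨e₁.trans (swap (e₁ a') b'), ?_, by simp⟩
  rw [Equiv.trans_apply, h1, swap_apply_of_ne_of_ne _ hb]
  rw [← h1]
  exact e₁.injective.ne ha

theorem vert_slotAt [NeZero m] {t : Fin (m + 2)} (ht : t.1 ≤ m) :
    ∃ v : Fin m, vert (slotAt t : HalfEdge p m) = Sum.inr v ∧ v.1 = (m + t.1 - 1) / 2 := by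
  rw [slotAt, dif_pos ht]
  exact ⟨_, rfl, rfl⟩

theorem vert_slotAt_last [NeZero m] {t : Fin (m + 2)} (ht : ¬ t.1 ≤ m) :
    vert (slotAt t : HalfEdge p m) = Sum.inr 0 := by
  rw [slotAt, dif_neg ht]; rfl

theorem exists_not_iso_of_two_le_labels [NeZero m] (hm : m + 2 = 2 * g + p) (hm2 : 2 ≤ m)
    (hp : 2 ≤ p) : ∃ G H : MarkedGraph p m, ¬ G.Iso H := by
  let e : (Fin p ⊕ Fin g) ⊕ Fin g ≃ Fin (m + 2) :=
    Fintype.equivOfCardEq (by simp; omega)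
  let i₀ : Fin p := ⟨0, by omega⟩
  let i₁ : Fin p := ⟨1, by omega⟩
  have hi : (.inl (.inl i₀) : (Fin p ⊕ Fin g) ⊕ Fin g) ≠ .inl (.inl i₁) := by simp [i₀, i₁]
  let a : Fin (m + 2) := ⟨m - 1, by omega⟩
  let b : Fin (m + 2) := ⟨m, by omega⟩
  let c : Fin (m + 2) := ⟨m + 1, by omega⟩
  obtain ⟨e₁, h1, h1'⟩ := exists_equiv_apply_eq e hi (b := a) (b' := b)
    (by simp only [a, b, ne_eq, Fin.mk.injEq]; omega)
  obtain ⟨e₂, h2, h2'⟩ := exists_equiv_apply_eq e hi (b := a) (b' := c)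
    (by simp only [a, c, ne_eq, Fin.mk.injEq]; omega)
  obtain ⟨G, hG⟩ := exists_graph e₁
  obtain ⟨H, hH⟩ := exists_graph e₂
  refine ⟨G, H, ?_⟩
  -- The first two marked vertices have a common neighbour in `G`, but not in `H`.
  rintro ⟨σ, τ, k1, k2, k3⟩
  have hσ : ∀ i, σ (Sum.inl i) = Sum.inl i := fun i => by
    have := k2 (Sum.inl i)
    rw [vert_inl, k1] at this
    rcases hy : σ (Sum.inl i) with j | ⟨v, l⟩
    · rw [hy] at this; simpa using this
    · rw [hy] at this; simp at this
  have hv : ∀ i, vert (H.opp (Sum.inl i)) = τ (vert (G.opp (Sum.inl i))) := fun i => by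
    rw [← k2, k3, hσ]
  have g0 : G.opp (Sum.inl i₀) = slotAt a := h1 ▸ hG (.inl (.inl i₀))
  have g1 : G.opp (Sum.inl i₁) = slotAt b := h1' ▸ hG (.inl (.inl i₁))
  have g2 : H.opp (Sum.inl i₀) = slotAt a := h2 ▸ hH (.inl (.inl i₀))
  have g3 : H.opp (Sum.inl i₁) = slotAt c := h2' ▸ hH (.inl (.inl i₁))
  obtain ⟨v, va, va'⟩ := vert_slotAt (p := p) (t := a) (by simp [a])
  obtain ⟨w, vb, vb'⟩ := vert_slotAt (p := p) (t := b) (by simp [b])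
  have vc := vert_slotAt_last (p := p) (t := c) (by simp [c])
  have hvw : v = w := by ext; rw [va', vb']; simp only [a, b]; omega
  have e0 := hv i₀
  have e1 := hv i₁
  rw [g0, g2, va] at e0
  rw [g1, g3, vb, vc, ← hvw, ← e0] at e1
  simp only [Sum.inr.injEq] at e1
  rw [← e1] at va'
  simp [a] at va'
  omega

theorem exists_not_iso_of_two_le_rank [NeZero m] (hm : m + 2 = 2 * g + p) (hm2 : 2 ≤ m)
    (hg : 2 ≤ g) : ∃ G H : MarkedGraph p m, ¬ G.Iso H := by
  let e : (Fin p ⊕ Fin g) ⊕ Fin g ≃ Fin (m + 2) :=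
    ((sumCongr finSumFinEquiv (Equiv.refl _)).trans finSumFinEquiv).trans
      (finCongr (by omega))
  let i₀ : Fin g := ⟨0, by omega⟩
  let a : Fin (m + 2) := ⟨m - 1, by omega⟩
  let b : Fin (m + 2) := ⟨m, by omega⟩
  obtain ⟨e₁, h1, h1'⟩ := exists_equiv_apply_eq e (a := .inl (.inr i₀)) (a' := .inr i₀)
    (b := a) (b' := b) (by simp) (by simp only [a, b, ne_eq, Fin.mk.injEq]; omega)
  obtain ⟨G, hG⟩ := exists_graph e₁
  obtain ⟨H, hH⟩ := exists_graph e
  refine ⟨G, H, ?_⟩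
  -- There is a loop in `G`, but none in `H`.
  rintro ⟨σ, τ, k1, k2, k3⟩
  have hloop : ∃ x, vert x = vert (G.opp x) := by
    have g0 : G.opp (slotAt b) = slotAt a := by
      have := hG (.inl (.inr (.inr i₀)))
      simpa only [halves, Sum.swap_inl, h1, h1'] using this
    refine ⟨slotAt b, ?_⟩
    obtain ⟨v, va, va'⟩ := vert_slotAt (p := p) (t := a) (by simp [a])
    obtain ⟨w, vb, vb'⟩ := vert_slotAt (p := p) (t := b) (by simp [b])
    rw [g0, va, vb]
    congr 1
    ext
    rw [va', vb']; simp only [a, b]; omega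
  have hnone : ∀ x, vert x ≠ vert (H.opp x) := by
    suffices K : ∀ z, vert (halves e (.inl z)) ≠ vert (halves e (.inr z)) by
      intro x
      obtain ⟨y, rfl⟩ := (halves_bijective e).2 x
      rw [hH]
      rcases y with z | z
      · exact K z
      · exact (K z).symm
    rintro (i | ⟨v, hv⟩ | i)
    · intro h
      rcases hx : halves e (.inr (.inl i)) with j | ⟨v, l⟩
      · exact slotAt_ne_inl _ _ hx
      · rw [hx] at h; simp [halves] at h
    · intro h
      simp only [halves, up, down, vert_inr, Sum.inr.injEq] at h
      have := par_lt hv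
      rw [← h] at this
      exact lt_irrefl _ this
    · -- The two ends have indices `p + g + i` and `p + i` in the enumeration.
      intro h
      have ei : (e (.inr i)).1 = p + g + i.1 := by simp [e]
      have ei' : (e (.inl (.inr i))).1 = p + i.1 := by simp [e]
      have hi := i.2
      obtain ⟨v, va, va'⟩ := vert_slotAt (p := p) (t := e (.inl (.inr i))) (by omega)
      simp only [halves] at h
      by_cases hle : (e (.inr i)).1 ≤ m
      · obtain ⟨w, vb, vb'⟩ := vert_slotAt (p := p) hle
        rw [va, vb, Sum.inr.injEq] at h
        rw [h, va', ei, ei'] at vb'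
        omega
      · rw [va, vert_slotAt_last hle, Sum.inr.injEq] at h
        rw [← h, ei'] at va'
        simp at va'
        omega
  obtain ⟨x, hx⟩ := hloop
  refine hnone (σ x) ?_
  rw [← k3, k2, k2, hx]

/-! ### The diameter -/

theorem diam_classGraph_le [NeZero m] (hm : m + 2 = 2 * g + p) :
    (classGraph p m).Connected ∧ (classGraph p m).ediam ≠ ⊤ ∧
      (classGraph p m).diam ≤ 6 * Nat.log 2 m * (5 * m + p) := by
  let e : (Fin p ⊕ Fin g) ⊕ Fin g ≃ Fin (m + 2) :=
    Fintype.equivOfCardEq (by simp; omega)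
  obtain ⟨G, -⟩ := exists_graph e
  have hwalk : ∀ x y, ∃ w : (classGraph p m).Walk x y,
      w.length ≤ 6 * Nat.log 2 m * (5 * m + p) := by
    intro x y
    induction x using Quotient.inductionOn with
    | _ G =>
    induction y using Quotient.inductionOn with
    | _ H => exact within_of_neZero G H
  have hle : (classGraph p m).ediam ≤ (6 * Nat.log 2 m * (5 * m + p) : ℕ) := by
    refine SimpleGraph.ediam_le_of_edist_le fun x y => ?_
    obtain ⟨w, hw⟩ := hwalk x y
    exact (SimpleGraph.edist_le w).trans (by exact_mod_cast hw)
  refine ⟨(SimpleGraph.connected_iff _).2 ⟨fun x y => ?_, ⟨⟦G⟧⟩⟩, fun h => ?_, ?_⟩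
  · obtain ⟨w, -⟩ := hwalk x y
    exact ⟨w⟩
  · rw [h] at hle
    exact ENat.natCast_ne_top _ (top_le_iff.1 hle)
  · exact ENat.toNat_le_of_le_natCast hle

/-- The number of graphs is at least `(g + p)!` up to an exponential factor, and each move
multiplies the number of graphs that can be reached only by a bounded factor. -/
theorem factorial_le_of_diam [NeZero m] (hm : m + 2 = 2 * g + p) :
    (g + p).factorial ≤ ((classGraph p m).diam + 1) * 4 ^ m * 144 ^ (classGraph p m).diam *
      ((p + m) * 27 ^ m) := by
  obtain ⟨hconn, htop, -⟩ := diam_classGraph_le hm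
  obtain ⟨x⟩ := hconn.nonempty
  induction x using Quotient.inductionOn with
  | _ G =>
  refine (factorial_le hm).trans (Nat.mul_le_mul_right _ (card_classes_le G _ fun y => ?_))
  obtain ⟨w, hw⟩ := hconn.exists_walk_length_eq_dist ⟦G⟧ y
  exact ⟨w, hw.trans_le (SimpleGraph.dist_le_diam htop)⟩

theorem one_le_diam [NeZero m] (hm : m + 2 = 2 * g + p) (hm2 : 2 ≤ m) :
    1 ≤ (classGraph p m).diam := by
  obtain ⟨hconn, htop, -⟩ := diam_classGraph_le hm
  obtain ⟨G, H, hGH⟩ : ∃ G H : MarkedGraph p m, ¬ G.Iso H := by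
    rcases le_or_gt 2 p with hp | hp
    · exact exists_not_iso_of_two_le_labels hm hm2 hp
    · exact exists_not_iso_of_two_le_rank hm hm2 (by omega)
  have hne : (⟦G⟧ : Quotient (MarkedGraph.isoSetoid p m)) ≠ ⟦H⟧ := fun h =>
    hGH (Quotient.exact h)
  exact (hconn.pos_dist_of_ne hne).trans_le (SimpleGraph.dist_le_diam htop)

theorem mul_log_le [NeZero m] (hm : m + 2 = 2 * g + p) (hn : 2 ≤ g + p) :
    ((g : ℝ) + p) * Real.log (g + p) ≤
      144 * ((classGraph p m).diam : ℝ) + 218 * ((g : ℝ) + p) := by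
  have hfac := factorial_le_of_diam hm
  set D := (classGraph p m).diam
  have hm0 := NeZero.pos m
  have hfac' : ((g + p).factorial : ℝ) ≤ ((D : ℝ) + 1) * 4 ^ m * 144 ^ D *
      (((p : ℝ) + m) * 27 ^ m) := by exact_mod_cast hfac
  have hmR : (0 : ℝ) < m := by exact_mod_cast hm0
  have hmn : (m : ℝ) + 2 = 2 * g + p := by exact_mod_cast hm
  have hp0 : (0 : ℝ) ≤ p := Nat.cast_nonneg _
  have hD0 : (0 : ℝ) ≤ D := Nat.cast_nonneg _
  have hg0 : (0 : ℝ) ≤ g := Nat.cast_nonneg _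
  have hnR : (0 : ℝ) < (g : ℝ) + p := by exact_mod_cast (by omega : 0 < g + p)
  -- The lower estimate `n ^ n / n! ≤ exp n` of the factorial.
  have h1 : ((g : ℝ) + p) * Real.log (g + p) - (g + p) ≤ Real.log ((g + p).factorial : ℝ) := by
    have hf : (0 : ℝ) < ((g + p).factorial : ℝ) := by exact_mod_cast Nat.factorial_pos _
    have := Real.log_le_log (by positivity)
      (Real.pow_div_factorial_le_exp ((g : ℝ) + p) hnR.le (g + p))
    rw [Real.log_exp, Real.log_div (by positivity) hf.ne', Real.log_pow] at this
    push_cast at this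
    linarith
  have h2 := h1.trans (Real.log_le_log (by exact_mod_cast Nat.factorial_pos _) hfac')
  rw [Real.log_mul (by positivity) (by positivity), Real.log_mul (by positivity) (by positivity),
    Real.log_mul (by positivity) (by positivity), Real.log_mul (by positivity) (by positivity),
    Real.log_pow, Real.log_pow, Real.log_pow] at h2
  have l1 := Real.log_le_sub_one_of_pos (by positivity : (0 : ℝ) < (D : ℝ) + 1)
  have l2 := Real.log_le_sub_one_of_pos (by positivity : (0 : ℝ) < (p : ℝ) + m)
  have l3 := mul_le_mul_of_nonneg_left
    (Real.log_le_sub_one_of_pos (by norm_num : (0 : ℝ) < 4)) hmR.le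
  have l4 := mul_le_mul_of_nonneg_left
    (Real.log_le_sub_one_of_pos (by norm_num : (0 : ℝ) < 27)) hmR.le
  have l5 := mul_le_mul_of_nonneg_left
    (Real.log_le_sub_one_of_pos (by norm_num : (0 : ℝ) < 144)) hD0
  linarith

theorem natLog_two_mul_le {n : ℕ} (hn : 2 ≤ n) (hm : m ≤ 2 * n) (hm0 : 0 < m) :
    (Nat.log 2 m : ℝ) ≤ 2 * Real.log n / Real.log 2 := by
  have hlog2 : 0 < Real.log 2 := Real.log_pos one_lt_two
  rw [le_div_iff₀ hlog2, ← Real.log_pow]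
  have h1 : (2 : ℝ) ^ Nat.log 2 m ≤ 2 * n := by
    exact_mod_cast (Nat.pow_log_le_self 2 hm0.ne').trans hm
  have h2 : (2 : ℝ) ≤ n := by exact_mod_cast hn
  have h3 := Real.log_le_log (by positivity) h1
  rw [Real.log_mul (by norm_num) (by positivity)] at h3
  have h4 := Real.log_le_log (by norm_num) h2
  linarith

/-- The term linear in `g + p` in `mul_log_le` is absorbed as soon as `log (g + p) ≥ 2 * 218`. -/
theorem diam_bounds [NeZero m] (hm : m + 2 = 2 * g + p) :
    ((classGraph p m).diam : ℝ) ≤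
        132 / Real.log 2 * (((g : ℝ) + p) * Real.log ((g : ℝ) + p)) ∧
      (2 ≤ m → 1 / (288 + 436 * Real.exp 436) * (((g : ℝ) + p) * Real.log ((g : ℝ) + p)) ≤
        ((classGraph p m).diam : ℝ)) := by
  have hlog2 : 0 < Real.log 2 := Real.log_pos one_lt_two
  have hm0 := NeZero.pos m
  obtain ⟨-, -, hdiam⟩ := diam_classGraph_le hm
  have hn : 2 ≤ g + p := by omega
  have hnR : (2 : ℝ) ≤ (g : ℝ) + p := by exact_mod_cast hn
  have hlog : 0 < Real.log ((g : ℝ) + p) := Real.log_pos (by linarith)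
  refine ⟨?_, fun h2m => ?_⟩
  · have hL := natLog_two_mul_le (m := m) hn (by omega) (by omega)
    have hmp : (5 * (m : ℝ) + p) ≤ 11 * ((g : ℝ) + p) := by
      exact_mod_cast (by omega : 5 * m + p ≤ 11 * (g + p))
    push_cast at hL
    calc ((classGraph p m).diam : ℝ)
        ≤ 6 * (Nat.log 2 m : ℝ) * (5 * m + p) := by exact_mod_cast hdiam
      _ ≤ 6 * (2 * Real.log ((g : ℝ) + p) / Real.log 2) * (11 * ((g : ℝ) + p)) := by gcongr
      _ = 132 / Real.log 2 * (((g : ℝ) + p) * Real.log ((g : ℝ) + p)) := by ring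
  · have hD : (1 : ℝ) ≤ (classGraph p m).diam := by
      exact_mod_cast one_le_diam hm h2m
    have hmul := mul_log_le hm hn
    rw [one_div, inv_mul_le_iff₀ (by positivity)]
    have hexp := Real.exp_pos 436
    rcases le_or_gt 436 (Real.log ((g : ℝ) + p)) with hbig | hsmall
    · -- The linear error term is at most half of `n log n`.
      have h1 : 436 * ((g : ℝ) + p) ≤ ((g : ℝ) + p) * Real.log ((g : ℝ) + p) := by
        rw [mul_comm]; gcongr
      have h2 : 0 ≤ 436 * Real.exp 436 * ((classGraph p m).diam : ℝ) := by
        positivity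
      linarith
    · -- Here `n` is bounded, and it suffices that there are two different graphs.
      have h1 : (g : ℝ) + p ≤ Real.exp 436 :=
        ((Real.log_lt_iff_lt_exp (by linarith)).1 hsmall).le
      have h2 : ((g : ℝ) + p) * Real.log ((g : ℝ) + p) ≤ Real.exp 436 * 436 := by gcongr
      have h3 : (288 + 436 * Real.exp 436) * 1 ≤ (288 + 436 * Real.exp 436) *
          ((classGraph p m).diam : ℝ) := by gcongr
      linarith

end TrivalentGraphs

theorem mainTheorem9 :
    ∃ c C : ℝ, 0 < c ∧ 0 < C ∧
      ∀ g p : ℕ, 2 < 2 * g + p →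
        (TrivalentGraphs.whiteheadGraph g p).Connected ∧
        (TrivalentGraphs.whiteheadGraph g p).ediam ≠ ⊤ ∧
        ((TrivalentGraphs.whiteheadGraph g p).diam : ℝ)
          ≤ C * (((g : ℝ) + p) * Real.log ((g : ℝ) + p)) ∧
        ((g, p) ≠ (0, 3) → (g, p) ≠ (1, 1) →
          c * (((g : ℝ) + p) * Real.log ((g : ℝ) + p))
            ≤ ((TrivalentGraphs.whiteheadGraph g p).diam : ℝ)) := by
  refine ⟨1 / (288 + 436 * Real.exp 436), 132 / Real.log 2, by positivity,
    div_pos (by norm_num) (Real.log_pos one_lt_two), fun g p hgp => ?_⟩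
  have hm : 2 * g + p - 2 + 2 = 2 * g + p := by omega
  have : NeZero (2 * g + p - 2) := ⟨by omega⟩
  obtain ⟨hconn, htop, -⟩ := TrivalentGraphs.diam_classGraph_le hm
  obtain ⟨hupper, hlower⟩ := TrivalentGraphs.diam_bounds hm
  refine ⟨hconn, htop, hupper, fun h03 h11 => hlower ?_⟩
  simp only [ne_eq, Prod.mk.injEq] at h03 h11
  omega
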